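/- Let $R$ be a commutative Noetherian local ring, let $\mathfrak a$ be an ideal of $R$, and let $M$ be a finitely generated $R$-module with dual $M^\ast=\operatorname{Hom}_R(M,R)$. Suppose that $M$ is locally free over $\operatorname{Spec}(R)\setminus V(\mathfrak a)$ (that is, $M_{\mathfrak p}$ is a free $R_{\mathfrak p}$-module for every prime $\mathfrak p\not\supseteq\mathfrak a$), that $M$ has finite projective dimension, and that $M^\ast\neq 0$ if $M\neq 0$. For a finitely generated $R$-module $N$, let $\operatorname{grade}(\mathfrak a,N)\in\mathbb N\cup\{\infty\}$ be the supremum of the lengths of the $N$-regular sequences contained in $\mathfrak a$ if $\mathfrak aN\neq N$, and $\infty$ if $\mathfrak aN=N$. If $$\operatorname{grade}(\mathfrak a,M)+\operatorname{grade}(\mathfrak a,M^\ast)\ \geq\ \dim R+2,$$ then $M$ is free. -/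

import Mathlib

open CategoryTheory

universe u v

namespace GradeFree

open Classical in
/-- The grade of the ideal `a` on the module `M`: the supremum of the lengths of the `M`-regular
sequences contained in `a` if `a M ≠ M`, and `∞` if `a M = M`. -/
noncomputable def idealGrade {R : Type*} [CommRing R] (a : Ideal R)
    (M : Type*) [AddCommGroup M] [Module R M] : ℕ∞ :=
  if a • (⊤ : Submodule R M) = ⊤ then ⊤
  else ⨆ rs ∈ {rs : List R | (∀ r ∈ rs, r ∈ a) ∧ RingTheory.Sequence.IsRegular M rs},
    (rs.length : ℕ∞)

/-- `M` is locally free over `Spec R ∖ V(a)`: the localization of `M` at each prime ideal not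
containing `a` is free. -/
def IsLocallyFreeOutside {R : Type*} [CommRing R] (a : Ideal R)
    (M : Type*) [AddCommGroup M] [Module R M] : Prop :=
  ∀ p : PrimeSpectrum R, p ∉ PrimeSpectrum.zeroLocus (a : Set R) →
    Module.Free (Localization.AtPrime p.asIdeal) (LocalizedModule p.asIdeal.primeCompl M)

end GradeFree

/-! Suppose `M` is not free and choose a prime `p` of least height at which it is not. Then `a ≤ p`,
`M_p` is free on the punctured spectrum of `R_p`, and regular sequences from `a` localize to weakly
regular sequences in the maximal ideal, while the dimension does not grow. So over a local ring `A`
one has `K` of finite projective dimension, free on the punctured spectrum, with `depth K ≥ g ≥ 2`,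
`depth K* ≥ h` and `g + h ≥ dim A + 2`. With `r = depth A ≤ dim A`, Auslander-Buchsbaum
(`hasProjectiveDimensionLE_sub`) gives `pd K ≤ r - g`, so `depth K* ≥ pd K + 2`. In that range
`free_of_extVanish_dual` inducts on syzygies: for `0 → L → F → K → 0`, the cokernel of `F* → L*`,
which is `Ext¹(K, A)`, has positive depth yet vanishes on the punctured spectrum, hence is zero.
Then `L` is free by induction and the sequence splits. Depth at least `t` is expressed throughout by
`ExtVanish`. -/

namespace GradeFree

open Abelian IsLocalRing

/-! ### Depth as vanishing of `Ext^i(k, -)`, along short exact sequences. -/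

section ExtVanish

variable (A : Type u) [CommRing A] [IsLocalRing A]

/-- The groups `Ext^i(k, X)` vanish for all `i < t`, where `k` is the residue field of `A`. -/
def ExtVanish (t : ℕ) (X : Type u) [AddCommGroup X] [Module A X] : Prop :=
  ∀ i < t, Subsingleton (Ext (ModuleCat.of.{u} A (ResidueField A)) (ModuleCat.of.{u} A X) i)

variable {A}
variable {X Y Z : Type u} [AddCommGroup X] [Module A X] [AddCommGroup Y] [Module A Y]
  [AddCommGroup Z] [Module A Z]

omit [IsLocalRing A] in
theorem shortExact_of_exact {f : X →ₗ[A] Y} {g : Y →ₗ[A] Z} (hf : Function.Injective f)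
    (hfg : Function.Exact f g) (hg : Function.Surjective g) :
    (ModuleCat.shortComplexOfCompEqZero f g hfg.linearMap_comp_eq_zero).ShortExact :=
  ModuleCat.shortComplex_shortExact _ hfg hf hg

theorem ExtVanish.mono {s t : ℕ} (h : ExtVanish A t X) (hst : s ≤ t) : ExtVanish A s X :=
  fun i hi => h i (hi.trans_le hst)

theorem ExtVanish.of_subsingleton [Subsingleton X] (t : ℕ) : ExtVanish A t X := fun i _ =>
  ⟨fun a b => by
    have h0 : 𝟙 (ModuleCat.of.{u} A X) = 0 := by
      ext x; exact Subsingleton.elim (α := X) _ _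
    have (c : Ext (ModuleCat.of.{u} A (ResidueField A)) (ModuleCat.of.{u} A X) i) : c = 0 := by
      rw [← Ext.comp_mk₀_id c, h0, Ext.mk₀_zero, Ext.comp_zero]
    rw [this a, this b]⟩

theorem ExtVanish.kernel {f : X →ₗ[A] Y} {g : Y →ₗ[A] Z} (hf : Function.Injective f)
    (hfg : Function.Exact f g) (hg : Function.Surjective g) {t : ℕ} (hY : ExtVanish A (t + 1) Y)
    (hZ : ExtVanish A t Z) : ExtVanish A (t + 1) X := by
  have hS := shortExact_of_exact hf hfg hg
  intro i hi
  refine subsingleton_of_forall_eq 0 fun e => ?_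
  have hz : e.comp (Ext.mk₀ (ModuleCat.shortComplexOfCompEqZero f g
    hfg.linearMap_comp_eq_zero).f) (add_zero i) = 0 := (hY i hi).elim _ _
  cases i with
  | zero =>
    have := hS.mono_f
    obtain ⟨e, rfl⟩ := (Ext.mk₀_bijective _ _).2 e
    rw [Ext.mk₀_comp_mk₀, Ext.mk₀_eq_zero_iff, ← Limits.zero_comp, cancel_mono] at hz
    rw [hz, Ext.mk₀_zero]
  | succ i =>
    obtain ⟨x, hx⟩ := Ext.covariant_sequence_exact₁ _ hS e hz rfl
    have h0 : x = 0 := (hZ i (by omega)).elim _ _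
    rw [← hx, h0, Ext.zero_comp]

theorem ExtVanish.cokernel {f : X →ₗ[A] Y} {g : Y →ₗ[A] Z} (hf : Function.Injective f)
    (hfg : Function.Exact f g) (hg : Function.Surjective g) {t : ℕ} (hY : ExtVanish A t Y)
    (hX : ExtVanish A (t + 1) X) : ExtVanish A t Z := by
  have hS := shortExact_of_exact hf hfg hg
  intro i hi
  refine subsingleton_of_forall_eq 0 fun e => ?_
  obtain ⟨y, hy⟩ := Ext.covariant_sequence_exact₃ _ hS e rfl ((hX (i + 1) (by omega)).elim _ _)
  have h0 : y = 0 := (hY i hi).elim _ _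
  rw [← hy, h0, Ext.zero_comp]

theorem ExtVanish.middle {f : X →ₗ[A] Y} {g : Y →ₗ[A] Z} (hf : Function.Injective f)
    (hfg : Function.Exact f g) (hg : Function.Surjective g) {t : ℕ} (hX : ExtVanish A t X)
    (hZ : ExtVanish A t Z) : ExtVanish A t Y := by
  have hS := shortExact_of_exact hf hfg hg
  intro i hi
  refine subsingleton_of_forall_eq 0 fun e => ?_
  obtain ⟨y, hy⟩ := Ext.covariant_sequence_exact₂ _ hS e ((hZ i hi).elim _ _)
  have h0 : y = 0 := (hX i hi).elim _ _
  rw [← hy, h0, Ext.zero_comp]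

theorem ExtVanish.congr (e : X ≃ₗ[A] Y) {t : ℕ} (h : ExtVanish A t X) : ExtVanish A t Y :=
  ExtVanish.middle (f := e.toLinearMap) (g := (0 : Y →ₗ[A] PUnit.{u + 1})) e.injective
    (fun y => ⟨fun _ => e.surjective y, fun _ => rfl⟩) (fun _ => ⟨0, rfl⟩) h
    (ExtVanish.of_subsingleton t)

theorem ExtVanish.pi {t : ℕ} (h : ExtVanish A t A) (n : ℕ) : ExtVanish A t (Fin n → A) := by
  induction n with
  | zero => exact ExtVanish.of_subsingleton t
  | succ n ih =>
    exact (ExtVanish.middle (f := LinearMap.inl A A (Fin n → A)) (g := LinearMap.snd A A _)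
      LinearMap.inl_injective Function.Exact.inl_snd Prod.snd_surjective h ih).congr
      (Fin.consLinearEquiv A fun _ : Fin (n + 1) => A)

theorem ExtVanish.free {t : ℕ} (h : ExtVanish A t A) (F : Type u) [AddCommGroup F] [Module A F]
    [Module.Free A F] [Module.Finite A F] : ExtVanish A t F :=
  (h.pi _).congr (Module.finBasis A F).equivFun.symm

theorem ext_comp_smul_eq_zero {i : ℕ}
    (e : Ext (ModuleCat.of.{u} A (ResidueField A)) (ModuleCat.of.{u} A X) i) {c : A}
    (hc : c ∈ maximalIdeal A) : c • e = 0 := by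
  have h0 : c • 𝟙 (ModuleCat.of.{u} A (ResidueField A)) = 0 := by
    ext x
    change c • x = 0
    rw [Algebra.smul_def, ResidueField.algebraMap_eq, (residue_eq_zero_iff c).2 hc, zero_mul]
  rw [← Ext.mk₀_id_comp e, ← Ext.smul_comp, ← Ext.mk₀_smul, h0, Ext.mk₀_zero, Ext.zero_comp]

theorem ext_comp_toSpanSingleton_eq_zero {i : ℕ}
    (e : Ext (ModuleCat.of.{u} A (ResidueField A)) (ModuleCat.of.{u} A A) i) {z : X}
    (hz : z ∈ maximalIdeal A • (⊤ : Submodule A X)) :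
    e.comp (Ext.mk₀ (ModuleCat.ofHom (LinearMap.toSpanSingleton A X z))) (add_zero i) = 0 := by
  induction hz using Submodule.smul_induction_on' with
  | smul c hc x _ =>
    have : ModuleCat.ofHom (LinearMap.toSpanSingleton A X (c • x)) =
        c • ModuleCat.ofHom (LinearMap.toSpanSingleton A X x) := by
      ext; simp
    rw [this, Ext.mk₀_smul, Ext.comp_smul, ext_comp_smul_eq_zero _ hc]
  | add x _ y _ hx hy =>
    have : ModuleCat.ofHom (LinearMap.toSpanSingleton A X (x + y)) =
        ModuleCat.ofHom (LinearMap.toSpanSingleton A X x) +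
          ModuleCat.ofHom (LinearMap.toSpanSingleton A X y) := by
      ext; simp
    rw [this, Ext.mk₀_add, Ext.comp_add, hx, hy, add_zero]

theorem exists_dual_apply_eq_one {F : Type u} [AddCommGroup F] [Module A F] [Module.Free A F]
    {v : F} (hv : v ∉ maximalIdeal A • (⊤ : Submodule A F)) : ∃ f : F →ₗ[A] A, f v = 1 := by
  let b := Module.Free.chooseBasis A F
  have : ∃ i, b.repr v i ∉ maximalIdeal A := by
    by_contra! H
    apply hv
    rw [← b.linearCombination_repr v, Finsupp.linearCombination_apply]
    exact Submodule.sum_mem _ fun i _ => Submodule.smul_mem_smul (H i) trivial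
  obtain ⟨i, hi⟩ := this
  obtain ⟨w, hw⟩ := not_not.1 ((mem_maximalIdeal _).not.1 hi)
  exact ⟨(w⁻¹ : Aˣ) • b.coord i, by simp [← hw, Units.smul_def]⟩

/-- If `Ext^r(k, A) ≠ 0`, then a linear map of finite free modules inducing an injective map on
`Ext^r(k, -)` splits. -/
theorem exists_leftInverse_of_ext_injective {r : ℕ}
    (hr : Nontrivial (Ext (ModuleCat.of.{u} A (ResidueField A)) (ModuleCat.of.{u} A A) r))
    [Module.Free A X] [Module.Finite A X] [Module.Free A Y] [Module.Finite A Y] (φ : X →ₗ[A] Y)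
    (hφ : ∀ e : Ext (ModuleCat.of.{u} A (ResidueField A)) (ModuleCat.of.{u} A X) r,
      e.comp (Ext.mk₀ (ModuleCat.ofHom φ)) (add_zero r) = 0 → e = 0) :
    ∃ ψ : Y →ₗ[A] X, ψ ∘ₗ φ = LinearMap.id := by
  rw [IsLocalRing.split_injective_iff_lTensor_residueField_injective,
    injective_iff_map_eq_zero]
  intro z hz
  obtain ⟨v, rfl⟩ := TensorProduct.mk_surjective A X (ResidueField A) residue_surjective z
  by_contra hv
  have mem_iff {W : Type u} [AddCommGroup W] [Module A W] (w : W) :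
      TensorProduct.mk A (ResidueField A) W 1 w = 0 ↔
        w ∈ maximalIdeal A • (⊤ : Submodule A W) := by
    rw [← LinearMap.ker_tensorProductMk]; rfl
  -- Push a nonzero class of `Ext^r(k, A)` along `v`. It stays nonzero because `f` retracts `v`, yet
  -- `φ` kills it because `φ v` lies in `𝔪Y` and `𝔪` annihilates `Ext(k, -)`.
  obtain ⟨f, hf⟩ := exists_dual_apply_eq_one (fun h => hv ((mem_iff v).2 h))
  obtain ⟨e, he⟩ := exists_ne (0 : Ext (ModuleCat.of.{u} A (ResidueField A))
    (ModuleCat.of.{u} A A) r)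
  apply he
  have hφv : φ v ∈ maximalIdeal A • (⊤ : Submodule A Y) := (mem_iff _).1 hz
  have h1 : ModuleCat.ofHom (LinearMap.toSpanSingleton A X v) ≫ ModuleCat.ofHom φ =
      ModuleCat.ofHom (LinearMap.toSpanSingleton A Y (φ v)) := by
    ext; simp
  have h2 : ModuleCat.ofHom (LinearMap.toSpanSingleton A X v) ≫ ModuleCat.ofHom f =
      𝟙 (ModuleCat.of.{u} A A) := by
    ext; simp [hf]
  have h3 := ext_comp_toSpanSingleton_eq_zero e hφv
  rw [← h1, ← Ext.mk₀_comp_mk₀, ← Ext.comp_assoc_of_third_deg_zero] at h3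
  rw [← Ext.comp_mk₀_id e, ← h2, ← Ext.mk₀_comp_mk₀, ← Ext.comp_assoc_of_third_deg_zero,
    hφ _ h3, Ext.zero_comp]

end ExtVanish

/-! ### Auslander-Buchsbaum inequality. -/

section AuslanderBuchsbaum

variable {A : Type u} [CommRing A] [IsLocalRing A]

theorem free_of_hasProjectiveDimensionLE_zero (K : Type u) [AddCommGroup K] [Module A K]
    [Module.Finite A K] (h : HasProjectiveDimensionLE (ModuleCat.of.{u} A K) 0) :
    Module.Free A K := by
  rw [← projective_iff_hasProjectiveDimensionLE_zero, ← IsProjective.iff_projective] at h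
  exact Module.free_of_flat_of_isLocalRing

variable [IsNoetherianRing A]

/-- The inductive step of the Auslander-Buchsbaum inequality. -/
theorem hasProjectiveDimensionLE_of_extVanish {r : ℕ}
    (hr : Nontrivial (Ext (ModuleCat.of.{u} A (ResidueField A)) (ModuleCat.of.{u} A A) r))
    (hA : ExtVanish A r A) (n g : ℕ) (hgn : r ≤ g + n) (K : Type u) [AddCommGroup K] [Module A K]
    [Module.Finite A K] (hg : ExtVanish A g K)
    (h : HasProjectiveDimensionLE (ModuleCat.of.{u} A K) (n + 1)) :
    HasProjectiveDimensionLE (ModuleCat.of.{u} A K) n := by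
  induction n generalizing K g with
  | zero =>
    obtain ⟨F, _, _, _, _, f, hf⟩ := Module.exists_finite_presentation A K
    have hS := LinearMap.shortExact_shortComplexKer hf
    have hL := (hS.hasProjectiveDimensionLT_X₃_iff 0 inferInstance).1 h
    have : Module.Free A (LinearMap.ker f) := free_of_hasProjectiveDimensionLE_zero _ hL
    -- The kernel of `Ext^r(k, ker f) → Ext^r(k, F)` comes from `Ext^(r-1)(k, K)`, which vanishes
    -- since `r ≤ g`.
    obtain ⟨ψ, hψ⟩ := exists_leftInverse_of_ext_injective hr (LinearMap.ker f).subtype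
      fun e he => by
        cases r with
        | zero =>
          have := hS.mono_f
          obtain ⟨e, rfl⟩ := (Ext.mk₀_bijective _ _).2 e
          rw [Ext.mk₀_comp_mk₀, Ext.mk₀_eq_zero_iff, ← Limits.zero_comp,
            cancel_mono (f := LinearMap.shortComplexKer f |>.f)] at he
          rw [he, Ext.mk₀_zero]
        | succ r =>
          obtain ⟨x, hx⟩ := Ext.covariant_sequence_exact₁ _ hS e he rfl
          have h0 : x = 0 := (hg r (by omega)).elim _ _
          rw [← hx, h0, Ext.zero_comp]
    have hp : Module.Projective A K := by
      obtain ⟨-, l, hl⟩ := ((LinearMap.exact_subtype_ker_map f).split_tfae'.out 1 0).1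
        (⟨hf, ψ, hψ⟩ : Function.Surjective f ∧ ∃ l, l ∘ₗ (LinearMap.ker f).subtype = LinearMap.id)
      exact Module.Projective.of_split l f hl
    rw [← projective_iff_hasProjectiveDimensionLE_zero, ← IsProjective.iff_projective]
    exact hp
  | succ n ih =>
    obtain ⟨F, _, _, _, _, f, hf⟩ := Module.exists_finite_presentation A K
    have hS := LinearMap.shortExact_shortComplexKer hf
    have hL := (hS.hasProjectiveDimensionLT_X₃_iff (n + 1) inferInstance).1 h
    refine (hS.hasProjectiveDimensionLT_X₃_iff n inferInstance).2 ?_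
    cases r with
    | zero => exact ih 0 (by omega) (LinearMap.ker f) (fun i hi => absurd hi (by omega)) hL
    | succ r =>
      -- A syzygy gains one unit of depth, up to the depth of the ring, here `r + 1`.
      refine ih (min g r + 1) (by omega) (LinearMap.ker f) ?_ hL
      exact ExtVanish.kernel (LinearMap.ker f).subtype_injective
        (LinearMap.exact_subtype_ker_map f) hf ((hA.free F).mono (by omega))
        (hg.mono (by omega))

/-- The Auslander-Buchsbaum inequality. -/
theorem hasProjectiveDimensionLE_sub {r : ℕ}
    (hr : Nontrivial (Ext (ModuleCat.of.{u} A (ResidueField A)) (ModuleCat.of.{u} A A) r))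
    (hA : ExtVanish A r A) {n g : ℕ} (K : Type u) [AddCommGroup K] [Module A K]
    [Module.Finite A K] (hg : ExtVanish A g K)
    (h : HasProjectiveDimensionLE (ModuleCat.of.{u} A K) n) :
    HasProjectiveDimensionLE (ModuleCat.of.{u} A K) (r - g) := by
  obtain hn | hn := le_total n (r - g)
  · exact hasProjectiveDimensionLT_of_ge _ (n + 1) _ (by omega)
  · induction n, hn using Nat.le_induction with
    | base => exact h
    | succ n hn ih =>
      exact ih (hasProjectiveDimensionLE_of_extVanish hr hA n g (by omega) K hg h)

end AuslanderBuchsbaum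

/-! ### Regular sequences, depth and dimension. -/

section Depth

variable {A : Type u} [CommRing A] [IsLocalRing A] [IsNoetherianRing A]

theorem ExtVanish.of_isWeaklyRegular {X : Type u} [AddCommGroup X] [Module A X] [Module.Finite A X]
    {rs : List A} (h : RingTheory.Sequence.IsWeaklyRegular X rs)
    (hm : ∀ x ∈ rs, x ∈ maximalIdeal A) : ExtVanish A rs.length X := by
  cases subsingleton_or_nontrivial X with
  | inl _ => exact ExtVanish.of_subsingleton _
  | inr _ =>
    have hsupp : Module.support A (ResidueField A) ⊆
        PrimeSpectrum.zeroLocus (maximalIdeal A : Set A) := by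
      have : Module.annihilator A (ResidueField A) = maximalIdeal A :=
        Ideal.annihilator_quotient
      rw [Module.support_eq_zeroLocus, this]
    refine ModuleCat.subsingleton_ext_of_exists_isRegular (maximalIdeal A)
      (ModuleCat.of.{u} A (ResidueField A)) hsupp (ModuleCat.of.{u} A X) ?_ rs hm
      ((IsLocalRing.isRegular_iff_isWeaklyRegular_of_subset_maximalIdeal hm).2 h)
    exact lt_top_iff_ne_top.2 (Submodule.top_ne_ideal_smul_of_le_jacobson_annihilator
      (IsLocalRing.maximalIdeal_le_jacobson _)).symm

theorem length_le_ringKrullDim_of_isRegular {X : Type*} [AddCommGroup X] [Module A X]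
    [Module.Finite A X] (rs : List A) (h : RingTheory.Sequence.IsRegular X rs) :
    (rs.length : WithBot ℕ∞) ≤ ringKrullDim A := by
  have h1 := Module.supportDim_add_length_eq_supportDim_of_isRegular rs h
  have h2 : Nontrivial (X ⧸ Ideal.ofList rs • (⊤ : Submodule A X)) :=
    Submodule.Quotient.nontrivial_iff.2 h.2.symm
  have h3 : 0 ≤ Module.supportDim A (X ⧸ Ideal.ofList rs • (⊤ : Submodule A X)) := by
    have := Module.supportDim_ne_bot_of_nontrivial A
      (X ⧸ Ideal.ofList rs • (⊤ : Submodule A X))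
    obtain ⟨d, hd⟩ := WithBot.ne_bot_iff_exists.1 this
    rw [← hd]
    exact WithBot.coe_le_coe.2 zero_le
  calc (rs.length : WithBot ℕ∞) = 0 + rs.length := (zero_add _).symm
    _ ≤ _ := by gcongr
    _ = _ := h1
    _ ≤ _ := Module.supportDim_le_ringKrullDim A X

variable (A) in
theorem exists_nat_eq_ringKrullDim : ∃ d : ℕ, (d : WithBot ℕ∞) = ringKrullDim A := by
  obtain ⟨e, he⟩ := WithBot.ne_bot_iff_exists.1 (ringKrullDim_ne_bot (R := A))
  obtain ⟨d, rfl⟩ := ENat.ne_top_iff_exists.1 (fun h : e = ⊤ =>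
    ringKrullDim_ne_top (R := A) (by rw [← he, h]; rfl))
  exact ⟨d, he⟩

variable (A) in
/-- The depth of a Noetherian local ring is finite and at most its dimension. -/
theorem exists_nontrivial_ext : ∃ r : ℕ,
    Nontrivial (Ext (ModuleCat.of.{u} A (ResidueField A)) (ModuleCat.of.{u} A A) r) ∧
    ExtVanish A r A ∧ (r : WithBot ℕ∞) ≤ ringKrullDim A := by
  have key (t : ℕ) (ht : ExtVanish A t A) : (t : WithBot ℕ∞) ≤ ringKrullDim A := by
    have hsupp : Module.support A (ResidueField A) =
        PrimeSpectrum.zeroLocus (maximalIdeal A : Set A) := by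
      have : Module.annihilator A (ResidueField A) = maximalIdeal A :=
        Ideal.annihilator_quotient
      rw [Module.support_eq_zeroLocus, this]
    obtain ⟨rs, hl, -, hreg⟩ := ModuleCat.exists_isRegular_of_exists_subsingleton_ext
      (maximalIdeal A) t (ModuleCat.of.{u} A A)
      (lt_top_iff_ne_top.2 (Submodule.top_ne_ideal_smul_of_le_jacobson_annihilator
        (IsLocalRing.maximalIdeal_le_jacobson _)).symm)
      (ModuleCat.of.{u} A (ResidueField A)) hsupp ht
    exact hl ▸ length_le_ringKrullDim_of_isRegular rs hreg
  have hex : ∃ t, ¬ ExtVanish A t A := by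
    by_contra! H
    obtain ⟨d, hd⟩ := exists_nat_eq_ringKrullDim A
    have := key (d + 1) (H _)
    rw [← hd] at this
    exact absurd (Nat.cast_le.1 this) (by omega)
  classical
  obtain ⟨r, hr⟩ : ∃ r, Nat.find hex = r + 1 := Nat.exists_eq_succ_of_ne_zero fun h =>
    Nat.find_spec hex (h ▸ fun i hi => absurd hi (Nat.not_lt_zero i))
  have hA : ExtVanish A r A := not_not.1 (Nat.find_min hex (by omega))
  refine ⟨r, ?_, hA, key r hA⟩
  rw [← not_subsingleton_iff_nontrivial]
  intro hs
  apply Nat.find_spec hex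
  rw [hr]
  intro i hi
  obtain hi | rfl := Nat.lt_succ_iff_lt_or_eq.1 hi
  exacts [hA i hi, hs]

end Depth

/-! ### Elementwise certificates of local freeness. -/

section FactorsFree

variable {A : Type*} [CommRing A]

/-- Multiplication by `s` on `K` factors through a finite free module. -/
def FactorsFree (s : A) (K : Type*) [AddCommGroup K] [Module A K] : Prop :=
  ∃ (n : ℕ) (α : K →ₗ[A] Fin n → A) (β : (Fin n → A) →ₗ[A] K), β ∘ₗ α = s • LinearMap.id

variable {K F : Type*} [AddCommGroup K] [Module A K] [AddCommGroup F] [Module A F]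

theorem FactorsFree.exists_section {s : A} (h : FactorsFree s K) {π : F →ₗ[A] K}
    (hπ : Function.Surjective π) : ∃ σ : K →ₗ[A] F, π ∘ₗ σ = s • LinearMap.id := by
  obtain ⟨n, α, β, hβ⟩ := h
  obtain ⟨γ, hγ⟩ := Module.projective_lifting_property π β hπ
  exact ⟨γ ∘ₗ α, by rw [← LinearMap.comp_assoc, hγ, hβ]⟩

/-- If `π ∘ σ = s`, then `s - σ ∘ π` lands in the kernel and is `s` there. Hence `s` annihilates the
obstruction to extending functionals from `ker π` to `F`. -/
theorem FactorsFree.exists_retraction {s : A} (h : FactorsFree s K) {π : F →ₗ[A] K}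
    (hπ : Function.Surjective π) :
    ∃ ρ : F →ₗ[A] LinearMap.ker π, ρ ∘ₗ (LinearMap.ker π).subtype = s • LinearMap.id := by
  obtain ⟨σ, hσ⟩ := h.exists_section hπ
  have hmem (x : F) : (s • (LinearMap.id : F →ₗ[A] F) - σ ∘ₗ π) x ∈ LinearMap.ker π := by
    have := LinearMap.congr_fun hσ (π x)
    simp only [LinearMap.comp_apply, LinearMap.smul_apply, LinearMap.id_apply] at this
    simp [this]
  exact ⟨(s • LinearMap.id - σ ∘ₗ π).codRestrict (LinearMap.ker π) hmem, by ext x; simp⟩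

theorem FactorsFree.ker {s : A} (h : FactorsFree s K) [Module.Free A F] [Module.Finite A F]
    [Nontrivial A] {π : F →ₗ[A] K} (hπ : Function.Surjective π) :
    FactorsFree s (LinearMap.ker π) := by
  obtain ⟨ρ, hρ⟩ := h.exists_retraction hπ
  let e := (Module.finBasis A F).equivFun
  refine ⟨_, e.toLinearMap ∘ₗ (LinearMap.ker π).subtype, ρ ∘ₗ e.symm.toLinearMap, ?_⟩
  rw [← hρ]
  ext x
  simp

theorem FactorsFree.projective {s : A} (h : FactorsFree s K) (hs : IsUnit s) :
    Module.Projective A K := by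
  obtain ⟨n, α, β, hβ⟩ := h
  obtain ⟨t, rfl⟩ := hs
  refine Module.Projective.of_split α ((t⁻¹ : Aˣ) • β) ?_
  rw [LinearMap.smul_comp, hβ]
  ext x
  simp [Units.smul_def, smul_smul]

/-- If the localization of `K` at a submonoid is free, then some element of the submonoid factors
through a finite free module. -/
theorem exists_factorsFree_of_free (S : Submonoid A) [Module.FinitePresentation A K]
    [Nontrivial (Localization S)]
    [Module.Free (Localization S) (LocalizedModule S K)] : ∃ s ∈ S, FactorsFree s K := by
  let b := (Module.finBasis (Localization S) (LocalizedModule S K)).equivFun.restrictScalars A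
  let n := Module.finrank (Localization S) (LocalizedModule S K)
  let i : (Fin n → A) →ₗ[A] (Fin n → Localization S) :=
    .pi fun j => Algebra.linearMap A (Localization S) ∘ₗ .proj j
  have : IsLocalizedModule S i := inferInstance
  let m := LocalizedModule.mkLinearMap S K
  obtain ⟨α, s, hα⟩ := Module.FinitePresentation.exists_lift_of_isLocalizedModule S i
    (b.toLinearMap ∘ₗ m)
  obtain ⟨β, t, hβ⟩ := Module.FinitePresentation.exists_lift_of_isLocalizedModule S m
    (b.symm.toLinearMap ∘ₗ i)
  obtain ⟨w, hw⟩ := Module.Finite.exists_smul_of_comp_eq_of_isLocalizedModule S m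
    (β ∘ₗ α) ((t * s) • LinearMap.id) (by
      ext x
      have h1 := LinearMap.congr_fun hα x
      have h2 := LinearMap.congr_fun hβ (α x)
      simp only [LinearMap.comp_apply, LinearMap.smul_apply, LinearEquiv.coe_coe,
        LinearMap.id_apply] at h1 h2 ⊢
      rw [h2, h1, Submonoid.smul_def s, map_smul, b.symm_apply_apply,
        Submonoid.smul_def, Submonoid.smul_def, Submonoid.coe_mul, map_smul, mul_smul])
  refine ⟨w * (t * s), (w * (t * s)).2, n, α, (w : A) • β, ?_⟩
  rw [LinearMap.smul_comp]
  ext x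
  have := LinearMap.congr_fun hw x
  simpa [Submonoid.smul_def, mul_smul] using this

theorem FactorsFree.localization {s : A} (h : FactorsFree s K) (S : Submonoid A) :
    FactorsFree (algebraMap A (Localization S) s) (LocalizedModule S K) := by
  obtain ⟨n, α, β, hβ⟩ := h
  let i : (Fin n → A) →ₗ[A] (Fin n → Localization S) :=
    .pi fun j => Algebra.linearMap A (Localization S) ∘ₗ .proj j
  have : IsLocalizedModule S i := inferInstance
  let m := LocalizedModule.mkLinearMap S K
  refine ⟨n, IsLocalizedModule.mapExtendScalars S m i (Localization S) α,
    IsLocalizedModule.mapExtendScalars S i m (Localization S) β, ?_⟩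
  apply LinearMap.restrictScalars_injective A
  apply IsLocalizedModule.linearMap_ext S m m
  ext x
  have := LinearMap.congr_fun hβ x
  simp only [LinearMap.comp_apply, LinearMap.smul_apply, LinearMap.id_apply] at this
  simp [this]

end FactorsFree

/-! ### Freeness from the depth of the dual. -/

section DualStep

variable {A : Type u} [CommRing A] [IsLocalRing A]

theorem ExtVanish.one_of_injective {X Y : Type u} [AddCommGroup X] [Module A X] [AddCommGroup Y]
    [Module A Y] {f : X →ₗ[A] Y} (hf : Function.Injective f) (h : ExtVanish A 1 Y) :
    ExtVanish A 1 X :=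
  ExtVanish.kernel hf (LinearMap.exact_map_mkQ_range f) (Submodule.mkQ_surjective _) h
    fun i hi => absurd hi (Nat.not_lt_zero i)

theorem ExtVanish.dual_one {K : Type u} [AddCommGroup K] [Module A K] [Module.Finite A K]
    (h : ExtVanish A 1 A) : ExtVanish A 1 (Module.Dual A K) := by
  obtain ⟨F, _, _, _, _, f, hf⟩ := Module.exists_finite_presentation A K
  exact ExtVanish.one_of_injective (LinearMap.dualMap_injective_of_surjective hf) (h.free _)

variable [IsNoetherianRing A]

theorem ExtVanish.exists_isSMulRegular {E : Type u} [AddCommGroup E] [Module A E]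
    [Module.Finite A E] (h : ExtVanish A 1 E) : ∃ x ∈ maximalIdeal A, IsSMulRegular E x := by
  have h0 := h 0 one_pos
  have : Subsingleton (ModuleCat.of.{u} A (ResidueField A) ⟶ ModuleCat.of.{u} A E) :=
    Ext.addEquiv₀.subsingleton_congr.mp h0
  have : Subsingleton (ResidueField A →ₗ[A] E) :=
    (ModuleCat.homAddEquiv (M := ModuleCat.of.{u} A (ResidueField A))
      (N := ModuleCat.of.{u} A E)).symm.subsingleton
  obtain ⟨x, hx, hreg⟩ := IsSMulRegular.subsingleton_linearMap_iff.1 this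
  have ha : Module.annihilator A (ResidueField A) = maximalIdeal A := Ideal.annihilator_quotient
  exact ⟨x, ha ▸ hx, hreg⟩

/-- A finite module of positive depth that vanishes on the punctured spectrum is zero. -/
theorem ExtVanish.subsingleton {E : Type u} [AddCommGroup E] [Module A E]
    [Module.Finite A E] (h : ExtVanish A 1 E)
    (hE : ∀ q : Ideal A, q.IsPrime → q ≠ maximalIdeal A → ∃ s ∉ q, ∀ e : E, s • e = 0) :
    Subsingleton E := by
  by_contra hn
  rw [not_subsingleton_iff_nontrivial] at hn
  obtain ⟨q, hq⟩ := associatedPrimes.nonempty A E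
  obtain ⟨hqp, e, he⟩ := isAssociatedPrime_iff.1 hq
  have mem_iff (x : A) : x ∈ q ↔ x • e = 0 := by
    rw [he, Submodule.mem_colon_singleton, Submodule.mem_bot]
  -- Off the maximal ideal some `s ∉ q` kills `E`, so `𝔪` is the only possible associated prime;
  -- positive depth excludes it.
  have hqm : q = maximalIdeal A := by
    by_contra hne
    obtain ⟨s, hsq, hs⟩ := hE q hqp hne
    exact hsq ((mem_iff s).2 (hs e))
  obtain ⟨x, hx, hreg⟩ := h.exists_isSMulRegular
  have he0 : e = 0 := hreg.right_eq_zero_of_smul ((mem_iff x).1 (hqm ▸ hx))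
  exact hqp.ne_top ((Ideal.eq_top_iff_one _).2 ((mem_iff 1).2 (by rw [he0, smul_zero])))

/-- Passing to a syzygy lowers both the bound on projective dimension and the known depth of the
dual by one, so the gap of two persists. That gap is what gives the cokernel of `F* → L*` positive
depth. -/
theorem free_of_extVanish_dual {r : ℕ} (hA : ExtVanish A r A) (n : ℕ) (hn : n + 2 ≤ r)
    (K : Type u) [AddCommGroup K] [Module A K] [Module.Finite A K]
    (hpd : HasProjectiveDimensionLE (ModuleCat.of.{u} A K) n)
    (hK : ∀ q : Ideal A, q.IsPrime → q ≠ maximalIdeal A → ∃ s ∉ q, FactorsFree s K)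
    (hdual : ExtVanish A (n + 2) (Module.Dual A K)) : Module.Free A K := by
  induction n generalizing K with
  | zero => exact free_of_hasProjectiveDimensionLE_zero K hpd
  | succ n ih =>
    obtain ⟨F, _, _, _, _, π, hπ⟩ := Module.exists_finite_presentation A K
    have hS := LinearMap.shortExact_shortComplexKer hπ
    have hL := (hS.hasProjectiveDimensionLT_X₃_iff n inferInstance).1 hpd
    let ι := (LinearMap.ker π).subtype
    have hex : Function.Exact π.dualMap ι.dualMap := by
      rw [LinearMap.exact_iff, LinearMap.ker_dualMap_eq_dualAnnihilator_range,
        LinearMap.range_dualMap_eq_dualAnnihilator_ker_of_surjective _ hπ,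
        Submodule.range_subtype]
    have hI : ExtVanish A (n + 2) (LinearMap.range ι.dualMap) :=
      ExtVanish.cokernel (g := ι.dualMap.rangeRestrict)
        (LinearMap.dualMap_injective_of_surjective hπ)
        (by rw [LinearMap.exact_iff, LinearMap.ker_rangeRestrict, ← LinearMap.exact_iff]; exact hex)
        ι.dualMap.surjective_rangeRestrict ((hA.free _).mono (by omega)) hdual
    have hE : ExtVanish A 1 (Module.Dual A (LinearMap.ker π) ⧸ LinearMap.range ι.dualMap) :=
      ExtVanish.cokernel (LinearMap.range ι.dualMap).subtype_injective
        (LinearMap.exact_subtype_mkQ _) (Submodule.mkQ_surjective _)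
        (ExtVanish.dual_one (hA.mono (by omega))) (hI.mono (by omega))
    have hE0 := hE.subsingleton fun q hq hqm => by
      obtain ⟨s, hsq, hs⟩ := hK q hq hqm
      refine ⟨s, hsq, fun e => ?_⟩
      obtain ⟨φ, rfl⟩ := Submodule.mkQ_surjective _ e
      obtain ⟨ρ, hρ⟩ := hs.exists_retraction hπ
      rw [← map_smul, Submodule.mkQ_apply, Submodule.Quotient.mk_eq_zero]
      refine ⟨φ ∘ₗ ρ, ?_⟩
      ext x
      simpa [ι] using congrArg φ (LinearMap.congr_fun hρ x)
    have htop : LinearMap.range ι.dualMap = ⊤ := Submodule.Quotient.subsingleton_iff.1 hE0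
    have hfree : Module.Free A (LinearMap.ker π) :=
      ih (by omega) (LinearMap.ker π) hL
        (fun q hq hqm => by
          obtain ⟨s, hsq, hs⟩ := hK q hq hqm
          exact ⟨s, hsq, hs.ker hπ⟩)
        (hI.congr (LinearEquiv.ofTop _ htop))
    -- Since `F* → L*` is onto, the coordinate functionals of the free syzygy extend to `F` and
    -- assemble into a retraction.
    have hsplit : ∃ ψ : F →ₗ[A] LinearMap.ker π, ψ ∘ₗ ι = LinearMap.id := by
      let b := Module.Free.chooseBasis A (LinearMap.ker π)
      have hc (j) : ∃ ψ : Module.Dual A F, ι.dualMap ψ = b.coord j := by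
        have : b.coord j ∈ LinearMap.range ι.dualMap := htop ▸ trivial
        exact this
      choose ψ hψ using hc
      refine ⟨∑ j, (ψ j).smulRight (b j), ?_⟩
      ext x
      have hcoord (j) : ψ j x = b.repr x j := LinearMap.congr_fun (hψ j) x
      simp only [LinearMap.comp_apply, LinearMap.sum_apply, LinearMap.smulRight_apply, ι,
        Submodule.subtype_apply, hcoord, b.sum_repr, LinearMap.id_apply]
    obtain ⟨ψ, hψ⟩ := hsplit
    have : Module.Projective A K := by
      obtain ⟨-, l, hl⟩ := ((LinearMap.exact_subtype_ker_map π).split_tfae'.out 1 0).1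
        (⟨hπ, ψ, hψ⟩ : Function.Surjective π ∧ ∃ l, l ∘ₗ (LinearMap.ker π).subtype = LinearMap.id)
      exact Module.Projective.of_split l π hl
    exact Module.free_of_flat_of_isLocalRing

end DualStep

/-! ### Reduction to the punctured spectrum, and the theorem. -/

open RingTheory.Sequence

theorem free_of_free_on_punctured {A : Type u} [CommRing A] [IsLocalRing A] [IsNoetherianRing A]
    (K : Type u) [AddCommGroup K] [Module A K] [Module.Finite A K] {n : ℕ}
    (hpd : HasProjectiveDimensionLE (ModuleCat.of.{u} A K) n)
    (hK : ∀ q : Ideal A, q.IsPrime → q ≠ maximalIdeal A → ∃ s ∉ q, FactorsFree s K)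
    {g h : ℕ} (hg : ExtVanish A g K) (hh : ExtVanish A h (Module.Dual A K)) (hg2 : 2 ≤ g)
    (hgh : ringKrullDim A + 2 ≤ ((g + h : ℕ) : WithBot ℕ∞)) : Module.Free A K := by
  obtain ⟨r, hr, hA, hrd⟩ := exists_nontrivial_ext A
  have hrgh : r + 2 ≤ g + h := by
    have h1 : ((r + 2 : ℕ) : WithBot ℕ∞) ≤ ((g + h : ℕ) : WithBot ℕ∞) := by
      refine le_trans ?_ hgh
      push_cast
      gcongr
    exact Nat.cast_le.1 h1
  have hpd' := hasProjectiveDimensionLE_sub hr hA K hg hpd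
  obtain hrg | hrg := le_total r g
  · rw [Nat.sub_eq_zero_of_le hrg] at hpd'
    exact free_of_hasProjectiveDimensionLE_zero K hpd'
  -- `g ≥ 2` gives `(r - g) + 2 ≤ r`, and `r + 2 ≤ g + h` gives `(r - g) + 2 ≤ h`.
  · exact free_of_extVanish_dual hA (r - g) (by omega) K hpd' hK (hh.mono (by omega))

theorem free_of_isWeaklyRegular {R : Type u} [CommRing R] [IsLocalRing R] [IsNoetherianRing R]
    (a : Ideal R) (M : Type u) [AddCommGroup M] [Module R M] [Module.Finite R M]
    (hfree : IsLocallyFreeOutside a M) {n : ℕ}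
    (hpd : HasProjectiveDimensionLE (ModuleCat.of.{u} R M) n) {rs rs' : List R}
    (hrs : IsWeaklyRegular M rs) (hrsa : ∀ x ∈ rs, x ∈ a)
    (hrs' : IsWeaklyRegular (Module.Dual R M) rs') (hrsa' : ∀ x ∈ rs', x ∈ a)
    (h2 : 2 ≤ rs.length)
    (hdim : ringKrullDim R + 2 ≤ ((rs.length + rs'.length : ℕ) : WithBot ℕ∞)) :
    Module.Free R M := by
  have hfp : Module.FinitePresentation R M := Module.finitePresentation_of_finite R M
  let T : Set (PrimeSpectrum R) := {p | ∀ s ∉ p.asIdeal, ¬ FactorsFree s M}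
  suffices hT : T = ∅ by
    have : closedPoint R ∉ T := hT ▸ Set.notMem_empty _
    obtain ⟨s, hs, hsM⟩ : ∃ s ∉ maximalIdeal R, FactorsFree s M := by
      simpa [T, closedPoint] using this
    have := hsM.projective (not_not.1 ((mem_maximalIdeal s).not.1 hs))
    exact Module.free_of_flat_of_isLocalRing
  by_contra hT
  -- `T` is the non-free locus. Minimal height puts every prime strictly below `p` outside `T`.
  obtain ⟨p, hpT, hpmin⟩ := WellFounded.has_min
    (InvImage.wf (fun p : PrimeSpectrum R => p.asIdeal.height) wellFounded_lt) T
    (Set.nonempty_iff_ne_empty.2 hT)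
  let A := Localization.AtPrime p.asIdeal
  let N := LocalizedModule p.asIdeal.primeCompl M
  have hNfree : ¬ Module.Free A N := fun _ => by
    obtain ⟨s, hs, hsM⟩ := exists_factorsFree_of_free (K := M) p.asIdeal.primeCompl
    exact hpT s hs hsM
  have hap : a ≤ p.asIdeal := by
    by_contra hap
    exact hNfree (hfree p hap)
  apply hNfree
  have hmem {l : List R} (hl : ∀ x ∈ l, x ∈ a) :
      ∀ x ∈ l.map (algebraMap R A), x ∈ maximalIdeal A := by
    intro x hx
    obtain ⟨y, hy, rfl⟩ := List.mem_map.1 hx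
    exact (IsLocalization.AtPrime.to_map_mem_maximal_iff A p.asIdeal y).2 (hap (hl y hy))
  have hregN : IsWeaklyRegular N (rs.map (algebraMap R A)) :=
    hrs.of_isLocalizedModule A p.asIdeal.primeCompl
      (LocalizedModule.mkLinearMap p.asIdeal.primeCompl M)
  have hregN' : IsWeaklyRegular (Module.Dual A N) (rs'.map (algebraMap R A)) :=
    hrs'.of_isLocalizedModule A p.asIdeal.primeCompl
      (IsLocalizedModule.mapExtendScalars p.asIdeal.primeCompl
        (LocalizedModule.mkLinearMap p.asIdeal.primeCompl M) (Algebra.linearMap R A) A)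
  have hpdN : HasProjectiveDimensionLE (ModuleCat.of.{u} A N) n := by
    have := ModuleCat.localizedModule_hasProjectiveDimensionLE n p.asIdeal.primeCompl
      (ModuleCat.of.{u} R M)
    exact ModuleCat.hasProjectiveDimensionLE_of_linearEquiv
      (M := (ModuleCat.of.{u} R M).localizedModule p.asIdeal.primeCompl)
      (N := ModuleCat.of.{u} A N) (Shrink.linearEquiv A N) n
  refine free_of_free_on_punctured N hpdN (fun q hq hqm => ?_)
    (ExtVanish.of_isWeaklyRegular hregN (hmem hrsa))
    (ExtVanish.of_isWeaklyRegular hregN' (hmem hrsa')) (by simpa using h2) ?_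
  · have hle : q.comap (algebraMap R A) ≤ p.asIdeal :=
      (Ideal.comap_mono (le_maximalIdeal hq.ne_top)).trans
        (IsLocalization.AtPrime.under_maximalIdeal A p.asIdeal).le
    have hlt : (⟨q.comap (algebraMap R A), inferInstance⟩ : PrimeSpectrum R) < p := by
      refine lt_of_le_of_ne hle fun h => hqm ?_
      rw [← IsLocalization.map_under p.asIdeal.primeCompl A q,
        ← IsLocalization.map_under p.asIdeal.primeCompl A (maximalIdeal A)]
      congr 1
      exact (congrArg PrimeSpectrum.asIdeal h).trans
        (IsLocalization.AtPrime.under_maximalIdeal A p.asIdeal).symm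
    have : (⟨q.comap (algebraMap R A), inferInstance⟩ : PrimeSpectrum R) ∉ T :=
      fun h => hpmin _ h (Ideal.height_strict_mono_of_isPrime_of_isPrime hlt)
    obtain ⟨s, hs, hsM⟩ : ∃ s ∉ q.comap (algebraMap R A), FactorsFree s M := by
      simpa [T] using this
    exact ⟨_, hs, hsM.localization _⟩
  · have hdimA : ringKrullDim A ≤ ringKrullDim R := by
      rw [IsLocalization.AtPrime.ringKrullDim_eq_height p.asIdeal A]
      exact Ideal.height_le_ringKrullDim_of_ne_top p.isPrime.ne_top
    rw [List.length_map, List.length_map]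
    exact le_trans (by gcongr) hdim

theorem exists_isRegular_of_le_idealGrade {R : Type*} [CommRing R] {a : Ideal R} {M : Type*}
    [AddCommGroup M] [Module R M] (h : a • (⊤ : Submodule R M) ≠ ⊤) {n : ℕ}
    (hn : (n : ℕ∞) ≤ idealGrade a M) :
    ∃ rs : List R, (∀ r ∈ rs, r ∈ a) ∧ IsRegular M rs ∧ n ≤ rs.length := by
  cases n with
  | zero =>
    have : Nontrivial M := (Submodule.nontrivial_iff R).mp (nontrivial_of_ne _ _ h)
    exact ⟨[], by simp, by simp [isRegular_iff], le_rfl⟩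
  | succ n =>
    rw [idealGrade, if_neg h] at hn
    have hlt : (n : ℕ∞) < _ := lt_of_lt_of_le (Nat.cast_lt.2 n.lt_succ_self) hn
    simp only [lt_iSup_iff] at hlt
    obtain ⟨rs, ⟨hrsa, hrs⟩, hlen⟩ := hlt
    exact ⟨rs, hrsa, hrs, Nat.cast_lt.1 hlen⟩

theorem idealGrade_le_ringKrullDim {R : Type*} [CommRing R] [IsLocalRing R] [IsNoetherianRing R]
    {a : Ideal R} {M : Type*} [AddCommGroup M] [Module R M] [Module.Finite R M]
    (h : a • (⊤ : Submodule R M) ≠ ⊤) {d : ℕ} (hd : (d : WithBot ℕ∞) = ringKrullDim R) :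
    idealGrade a M ≤ d := by
  rw [idealGrade, if_neg h]
  refine iSup₂_le fun rs hrs => ?_
  have := length_le_ringKrullDim_of_isRegular rs hrs.2
  rw [← hd] at this
  exact_mod_cast this

theorem smul_top_ne_top_of_ne_top {R : Type*} [CommRing R] [IsLocalRing R] {a : Ideal R}
    (ha : a ≠ ⊤) (M : Type*) [AddCommGroup M] [Module R M] [Module.Finite R M] [Nontrivial M] :
    a • (⊤ : Submodule R M) ≠ ⊤ :=
  (Submodule.top_ne_ideal_smul_of_le_jacobson_annihilator
    ((le_maximalIdeal ha).trans (IsLocalRing.maximalIdeal_le_jacobson _))).symm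

theorem IsLocallyFreeOutside.congr {R : Type*} [CommRing R] {a : Ideal R} {M N : Type*}
    [AddCommGroup M] [Module R M] [AddCommGroup N] [Module R N] (e : M ≃ₗ[R] N)
    (h : IsLocallyFreeOutside a M) : IsLocallyFreeOutside a N := fun p hp =>
  have := h p hp
  Module.Free.of_equiv (IsLocalizedModule.mapEquiv p.asIdeal.primeCompl
    (LocalizedModule.mkLinearMap p.asIdeal.primeCompl M)
    (LocalizedModule.mkLinearMap p.asIdeal.primeCompl N) (Localization.AtPrime p.asIdeal) e)

end GradeFree

theorem mainTheorem5 (R : Type u) [CommRing R] [IsLocalRing R] [IsNoetherianRing R]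
    (a : Ideal R)
    (M : Type v) [AddCommGroup M] [Module R M] [Module.Finite R M] [Small.{v} R]
    (hdual : Nontrivial M → Nontrivial (Module.Dual R M))
    (hfree : GradeFree.IsLocallyFreeOutside a M)
    (hpd : projectiveDimension (ModuleCat.of.{v} R M) ≠ ⊤)
    (hgrade : ringKrullDim R + 2 ≤
      ((GradeFree.idealGrade a M + GradeFree.idealGrade a (Module.Dual R M) : ℕ∞) : WithBot ℕ∞)) :
    Module.Free R M := by
  cases subsingleton_or_nontrivial M with
  | inl _ => exact Module.Free.of_subsingleton R M
  | inr hM =>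
  have hM' := hdual hM
  have hfp : Module.FinitePresentation R M := Module.finitePresentation_of_finite R M
  -- For the unit ideal both grades are infinite by convention, but then the closed point lies
  -- outside `V(a)` and local freeness there suffices.
  by_cases ha : a = ⊤
  · have := hfree (IsLocalRing.closedPoint R) (by simp [ha])
    obtain ⟨s, hs, hsM⟩ := GradeFree.exists_factorsFree_of_free (K := M)
      (IsLocalRing.closedPoint R).asIdeal.primeCompl
    have := hsM.projective (not_not.1 ((IsLocalRing.mem_maximalIdeal s).not.1 hs))
    exact Module.free_of_flat_of_isLocalRing
  have haM := GradeFree.smul_top_ne_top_of_ne_top ha M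
  have haM' := GradeFree.smul_top_ne_top_of_ne_top ha (Module.Dual R M)
  obtain ⟨d, hd⟩ := GradeFree.exists_nat_eq_ringKrullDim R
  have hle := GradeFree.idealGrade_le_ringKrullDim haM' hd
  obtain ⟨h, hh⟩ := ENat.ne_top_iff_exists.1 (ne_top_of_le_ne_top (ENat.natCast_ne_top d) hle)
  have hhd : h ≤ d := by rw [← hh] at hle; exact Nat.cast_le.1 hle
  -- The dual is nonzero, so its grade `h` is at most `d`. Thus `d + 2 - h` is not truncated and is
  -- at least 2, as the punctured case requires.
  have hG : ((d + 2 - h : ℕ) : ℕ∞) ≤ GradeFree.idealGrade a M := by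
    rw [← hd, ← hh] at hgrade
    have h1 : (d + 2 : ℕ∞) ≤ GradeFree.idealGrade a M + h := WithBot.coe_le_coe.1 hgrade
    rw [ENat.natCast_sub]
    exact tsub_le_iff_right.2 (by exact_mod_cast h1)
  obtain ⟨rs, hrsa, hrs, hlen⟩ := GradeFree.exists_isRegular_of_le_idealGrade haM hG
  obtain ⟨rs', hrsa', hrs', hlen'⟩ := GradeFree.exists_isRegular_of_le_idealGrade haM' hh.le
  obtain ⟨n, hn⟩ := (projectiveDimension_ne_top_iff _).1 hpd
  -- A quotient of `R^k` replaces `M` to bring the module into the universe of `R`.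
  obtain ⟨k, f, hf⟩ := Module.Finite.exists_fin' R M
  let e := f.quotKerEquivOfSurjective hf
  have hn' : HasProjectiveDimensionLE (ModuleCat.of.{u} R ((Fin k → R) ⧸ LinearMap.ker f)) n :=
    ModuleCat.hasProjectiveDimensionLE_of_linearEquiv.{v, u} (M := ModuleCat.of.{v} R M)
      (N := ModuleCat.of.{u} R ((Fin k → R) ⧸ LinearMap.ker f)) e.symm n
  have := GradeFree.free_of_isWeaklyRegular a ((Fin k → R) ⧸ LinearMap.ker f)
    (hfree.congr e.symm) hn' ((e.isWeaklyRegular_congr rs).2 hrs.1) hrsa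
    ((e.dualMap.isWeaklyRegular_congr rs').1 hrs'.1) hrsa' (by omega) (by
      rw [← hd]
      exact_mod_cast (by omega : d + 2 ≤ rs.length + rs'.length))
  exact Module.Free.of_equiv e
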